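/- Proposition 6.7. Let $\mathbb D$ be the open unit disc, $\mathbb T$ the unit circle and $H(\mathbb D)$ the set of holomorphic functions on $\mathbb D$. For a compact set $K\subset\mathbb T$, let $C(K)$ be the space of continuous complex-valued functions on $K$ with the topology of uniform convergence; for $f\in H(\mathbb D)$ and $r\in[0,1)$ put $f_r(z)=f(rz)$. Let $\varrho=(r_n)_{n\in\mathbb N}$ be a sequence of pairwise distinct numbers in $[0,1)$ converging to $1$. A function $f\in H(\mathbb D)$ is called $\varrho$-frequently Abel universal if for every compact $K\subset\mathbb T$ with $K\ne\mathbb T$ and every non-empty open set $V\subset C(K)$, the set $E=\{n\in\mathbb N: f_{r_n}|_K\in V\}$ has positive lower density, that is, $$\liminf_{n\to\infty}\frac{|E\cap\{1,\dots,n\}|}{n}>0.$$ It is called frequently Abel universal if for every such $K$ and $V$ the set $\Gamma=\{r\in[0,1): f_r|_K\in V\}$ has positive uniform lower density, that is, $$\liminf_{n\to\infty} n\,\bigl|\Gamma\cap[1-\tfrac1n,1)\bigr|>0,$$ where $|\cdot|$ is Lebesgue measure on $\mathbb R$. Denote by $\mathcal{FU}_A(\mathbb D,\varrho)$ and $\mathcal{FU}_A(\mathbb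 D)$ the corresponding sets of functions. Then $$H(\mathbb D)=\mathcal{FU}_A(\mathbb D,\varrho)+\mathcal{FU}_A(\mathbb D,\varrho)\qquad\text{and}\qquad H(\mathbb D)=\mathcal{FU}_A(\mathbb D)+\mathcal{FU}_A(\mathbb D).$$ -/

import Mathlib

open Filter Topology MeasureTheory
open scoped Pointwise

namespace AbelUniversal

/-- The space `H(𝔻)` of holomorphic functions on the open unit disc. A function on the disc is
represented by a total function `ℂ → ℂ`; its values outside the disc play no role in any of the
definitions below. -/
def holomorphicOnDisc : Set (ℂ → ℂ) :=
  {f | DifferentiableOn ℂ f (Metric.ball (0 : ℂ) 1)}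

/-- The set `N_f(V, K) = {r ∈ [0, 1) : f ∘ φ_r ∈ V}`, where `φ_r z = r z` and `V` is a set of
continuous functions on `K`: the restriction of `z ↦ f (r z)` to `K` is an element of `V`. -/
def visitRadii (f : ℂ → ℂ) (K : Set ℂ) (V : Set C(K, ℂ)) : Set ℝ :=
  {r | r ∈ Set.Ico (0 : ℝ) 1 ∧ ∃ φ ∈ V, ∀ z : K, φ z = f ((r : ℂ) * (z : ℂ))}

/-- The set `N_f(V, K, ϱ) = {n ∈ ℕ : f ∘ φ_{r_n} ∈ V}` for the sequence `ϱ = (r_n)`. -/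
def visitTimes (f : ℂ → ℂ) (K : Set ℂ) (V : Set C(K, ℂ)) (ϱ : ℕ → ℝ) : Set ℕ :=
  {n | ϱ n ∈ visitRadii f K V}

/-- The lower density `liminf |E ∩ {1, …, n}| / n` of a set of natural numbers. -/
noncomputable def lowerDensity (E : Set ℕ) : ℝ :=
  liminf (fun n : ℕ => ((E ∩ Set.Icc 1 n).ncard : ℝ) / (n : ℝ)) atTop

/-- The uniform lower density `liminf n |Γ ∩ [1 - 1/n, 1)|` of a subset of `[0, 1)`, where `|·|`
is the Lebesgue measure. -/
noncomputable def uniformLowerDensity (Γ : Set ℝ) : ℝ :=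
  liminf (fun n : ℕ => (n : ℝ) * volume.real (Γ ∩ Set.Ico (1 - 1 / (n : ℝ)) 1)) atTop

/-- The set of `ϱ`-frequently Abel universal functions. The space `C(K, ℂ)` carries the topology
of uniform convergence, since `K` is compact. -/
def seqFrequentlyAbelUniversal (ϱ : ℕ → ℝ) : Set (ℂ → ℂ) :=
  {f | f ∈ holomorphicOnDisc ∧
    ∀ K : Set ℂ, IsCompact K → K ⊆ Metric.sphere (0 : ℂ) 1 → K ≠ Metric.sphere (0 : ℂ) 1 →
      ∀ V : Set C(K, ℂ), IsOpen V → V.Nonempty → 0 < lowerDensity (visitTimes f K V ϱ)}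

/-- The set of frequently Abel universal functions. -/
def frequentlyAbelUniversal : Set (ℂ → ℂ) :=
  {f | f ∈ holomorphicOnDisc ∧
    ∀ K : Set ℂ, IsCompact K → K ⊆ Metric.sphere (0 : ℂ) 1 → K ≠ Metric.sphere (0 : ℂ) 1 →
      ∀ V : Set C(K, ℂ), IsOpen V → V.Nonempty → 0 < uniformLowerDensity (visitRadii f K V)}

end AbelUniversal

namespace AbelUniversal

open Polynomial

/-! ### Polynomial approximation on compact sets with connected complement -/

/-! Given `f`, one constructs a single holomorphic `g` for which both `g` and `f - g` are universal.
Countably many targets (compact set `κ j`, polynomial `p j`) test universality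
(`exists_seq_targets`). On a sequence of sectors over disjoint radius intervals tending to 1, `g` is
made close to `p j` on those with label `2 * j` and to `f - p j` on those with label `2 * j + 1`; on
the latter, `f - g` is close to `p j`. The label is a 2-adic valuation, so each label recurs along
an arithmetic progression, which gives the positive densities.

Such a `g` exists by `exists_approx_on_sectors`: each correction is small on the disc already
treated and prescribed on the next sector. The switching factor is a polynomial near 0 on the disc
and near 1 on the sector, obtained from a Runge-type theorem for inverses of polynomials
(`exists_polynomial_near_inv`). -/

theorem mem_elemental_restrict_id_iff {L : Set ℂ} [CompactSpace L] {φ : C(L, ℂ)} :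
    φ ∈ Algebra.elemental ℂ (ContinuousMap.restrict L (ContinuousMap.id ℂ)) ↔
      ∀ ε > 0, ∃ p : ℂ[X], ∀ z : L, ‖p.eval (z : ℂ) - φ z‖ < ε := by
  have key : ∀ (p : ℂ[X]) (z : L),
      (aeval (ContinuousMap.restrict L (ContinuousMap.id ℂ)) p) z = p.eval (z : ℂ) := by
    intro p z
    rw [Polynomial.aeval_continuousMap_apply]
    simp
  rw [Algebra.elemental, ← SetLike.mem_coe, Subalgebra.topologicalClosure_coe,
    Metric.mem_closure_iff]
  refine forall₂_congr fun ε hε => ?_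
  simp only [SetLike.mem_coe, Algebra.adjoin_singleton_eq_range_aeval, AlgHom.mem_range]
  constructor
  · rintro ⟨_, ⟨p, rfl⟩, h⟩
    rw [dist_comm, ContinuousMap.dist_lt_iff hε] at h
    exact ⟨p, fun z => by simpa only [key, dist_eq_norm] using h z⟩
  · rintro ⟨p, h⟩
    refine ⟨_, ⟨p, rfl⟩, ?_⟩
    rw [dist_comm, ContinuousMap.dist_lt_iff hε]
    exact fun z => by simpa only [key, dist_eq_norm] using h z

/-- Spectral permanence replaces Runge's theorem. The coordinate function has spectrum `L` in
`C(L)`; passing to the closed subalgebra it generates could only fill holes of `L`, and there are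
none. So `q` of the coordinate is already invertible inside the closure of the polynomials. -/
theorem exists_polynomial_near_inv {L : Set ℂ} (hL : IsCompact L) (hc : IsPreconnected Lᶜ)
    {q : ℂ[X]} (hq : ∀ z ∈ L, q.eval z ≠ 0) {ε : ℝ} (hε : 0 < ε) :
    ∃ p : ℂ[X], ∀ z ∈ L, ‖p.eval z - (q.eval z)⁻¹‖ < ε := by
  have : CompactSpace L := isCompact_iff_compactSpace.mp hL
  rcases L.eq_empty_or_nonempty with rfl | hne
  · exact ⟨0, by simp⟩
  have : Nonempty L := hne.to_subtype
  set x : C(L, ℂ) := ContinuousMap.restrict L (ContinuousMap.id ℂ) with hx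
  have hspec : spectrum ℂ x = L := by
    rw [ContinuousMap.spectrum_eq_range]
    ext z
    simp [hx]
  let S := Algebra.elemental ℂ x
  have hS : IsClosed (S : Set C(L, ℂ)) := Algebra.elemental.isClosed ℂ x
  let y : S := ⟨x, Algebra.elemental.self_mem ℂ x⟩
  have hy : spectrum ℂ y = L := by
    rw [Subalgebra.spectrum_eq_of_isPreconnected_compl S y (by rw [hspec]; exact hc), hspec]
  have hu : IsUnit (aeval y q) := by
    rw [← spectrum.zero_notMem_iff ℂ,
      spectrum.map_polynomial_aeval_of_nonempty y q (by rwa [hy]), hy]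
    rintro ⟨z, hz, h⟩
    exact hq z hz h
  obtain ⟨v, hv⟩ := hu.exists_right_inv
  obtain ⟨p, hp⟩ := mem_elemental_restrict_id_iff.mp v.2 ε hε
  refine ⟨p, fun z hz => ?_⟩
  have h1 : (aeval x q * (v : C(L, ℂ))) ⟨z, hz⟩ = 1 := by
    have h : aeval x q * (v : C(L, ℂ)) = 1 := by
      have := congrArg (fun w : S => (w : C(L, ℂ))) hv
      rwa [Subalgebra.coe_mul, Polynomial.aeval_subalgebra_coe] at this
    rw [h, ContinuousMap.one_apply]
  have h2 : q.eval z * (v : C(L, ℂ)) ⟨z, hz⟩ = 1 := by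
    rw [← h1, ContinuousMap.mul_apply, Polynomial.aeval_continuousMap_apply]
    simp [hx]
  rw [inv_eq_of_mul_eq_one_right h2]
  exact hp ⟨z, hz⟩

/-! ### Circular sectors -/

/-- The set of the points `r z` with `r ∈ [a, b]` and `z ∈ K`. -/
def sector (a b : ℝ) (K : Set ℂ) : Set ℂ :=
  (fun x : ℝ × ℂ => (x.1 : ℂ) * x.2) '' (Set.Icc a b ×ˢ K)

theorem mul_mem_sector {a b r : ℝ} {K : Set ℂ} {z : ℂ} (hr : r ∈ Set.Icc a b) (hz : z ∈ K) :
    (r : ℂ) * z ∈ sector a b K :=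
  ⟨(r, z), ⟨hr, hz⟩, rfl⟩

theorem isCompact_sector (a b : ℝ) {K : Set ℂ} (hK : IsCompact K) : IsCompact (sector a b K) :=
  (isCompact_Icc.prod hK).image (by fun_prop)

theorem norm_mem_Icc_of_mem_sector {a b : ℝ} {K : Set ℂ} (hK : K ⊆ Metric.sphere 0 1)
    (ha : 0 ≤ a) {w : ℂ} (hw : w ∈ sector a b K) : ‖w‖ ∈ Set.Icc a b := by
  obtain ⟨⟨r, z⟩, ⟨hr, hz⟩, rfl⟩ := hw
  have : ‖z‖ = 1 := by simpa using hK hz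
  simpa [this, abs_of_nonneg (ha.trans hr.1)] using hr

theorem norm_ofReal_mul_exp {r : ℝ} (hr : 0 ≤ r) (θ : ℝ) :
    ‖(r : ℂ) * Complex.exp (θ * Complex.I)‖ = r := by
  rw [norm_mul, Complex.norm_exp_ofReal_mul_I, mul_one, Complex.norm_real, Real.norm_of_nonneg hr]

theorem polar_mem_compl_iff {s a b r θ : ℝ} {K : Set ℂ} (hK : K ⊆ Metric.sphere 0 1)
    (ha : 0 < a) (hr : 0 ≤ r) :
    (r : ℂ) * Complex.exp (θ * Complex.I) ∈ (Metric.closedBall 0 s ∪ sector a b K)ᶜ ↔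
      s < r ∧ (Complex.exp (θ * Complex.I) ∈ K → r ∉ Set.Icc a b) := by
  rw [Set.mem_compl_iff, Set.mem_union, not_or, mem_closedBall_zero_iff, norm_ofReal_mul_exp hr,
    not_le]
  refine and_congr_right fun _ => ⟨fun h hK' hr' => h (mul_mem_sector hr' hK'), fun h hw => ?_⟩
  have hn := norm_mem_Icc_of_mem_sector hK ha.le hw
  rw [norm_ofReal_mul_exp hr] at hn
  obtain ⟨⟨r', z⟩, ⟨hr', hz⟩, hw⟩ := hw
  have hz1 : ‖z‖ = 1 := by simpa using hK hz
  have hrr : r' = r := by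
    have := congrArg norm hw
    rw [norm_ofReal_mul_exp hr] at this
    simpa [hz1, abs_of_nonneg (ha.le.trans hr'.1)] using this
  subst hrr
  have hr0 : (r' : ℂ) ≠ 0 := by exact_mod_cast (ha.trans_le hr'.1).ne'
  have := mul_left_cancel₀ hr0 hw
  exact h (this ▸ hz) hn

/-- Every point of the complement reaches the region beyond radius `b`: along its own ray if its
direction avoids `K`, and otherwise, when below radius `a`, by turning in the annulus to a direction
`u` missed by `K`. -/
theorem isPreconnected_compl_closedBall_union_sector {s a b : ℝ} {K : Set ℂ}
    (hK : K ⊆ Metric.sphere 0 1) (hK' : K ≠ Metric.sphere 0 1) (hsa : s < a) (ha : 0 < a)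
    (hab : a ≤ b) : IsPreconnected (Metric.closedBall 0 s ∪ sector a b K)ᶜ := by
  let P : ℝ × ℝ → ℂ := fun x => (x.1 : ℂ) * Complex.exp (x.2 * Complex.I)
  have hP : Continuous P := by fun_prop
  have hpc : ∀ S T : Set ℝ, IsPreconnected S → IsPreconnected T → IsPreconnected (P '' (S ×ˢ T)) :=
    fun S T hS hT => (hS.prod hT).image P hP.continuousOn
  obtain ⟨u, hu, huK⟩ : ∃ u ∈ Metric.sphere (0 : ℂ) 1, u ∉ K := by
    by_contra! h
    exact hK' (hK.antisymm h)
  have polar : ∀ w : ℂ, w = (‖w‖ : ℂ) * Complex.exp (w.arg * Complex.I) :=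
    fun w => (Complex.norm_mul_exp_arg_mul_I w).symm
  have hu' : Complex.exp (u.arg * Complex.I) ∉ K := by
    have h := polar u
    rw [mem_sphere_zero_iff_norm] at hu
    rw [hu, Complex.ofReal_one, one_mul] at h
    rwa [← h]
  have hmem : ∀ {r θ : ℝ}, 0 ≤ r → s < r →
      (Complex.exp (θ * Complex.I) ∈ K → r ∉ Set.Icc a b) →
      P (r, θ) ∈ (Metric.closedBall 0 s ∪ sector a b K)ᶜ :=
    fun hr hs h => (polar_mem_compl_iff hK ha hr).mpr ⟨hs, h⟩
  have hb : 0 < b := ha.trans_le hab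
  have hsb : s < b := hsa.trans_le hab
  let outer : Set ℂ := P '' (Set.Ioi b ×ˢ Set.univ)
  -- Here `s` may be negative, so nonnegativity of the radius has to be imposed separately.
  let ray : ℝ → Set ℂ := fun θ => P '' ((Set.Ici 0 ∩ Set.Ioi s) ×ˢ {θ})
  let annulus : Set ℂ := P '' ((Set.Ici 0 ∩ Set.Ioo s a) ×ˢ Set.univ)
  have hray : ∀ θ, IsPreconnected (ray θ) := fun θ =>
    hpc _ _ (Set.OrdConnected.inter Set.ordConnected_Ici Set.ordConnected_Ioi).isPreconnected
      isPreconnected_singleton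
  have hannulus : IsPreconnected annulus :=
    hpc _ _ (Set.OrdConnected.inter Set.ordConnected_Ici Set.ordConnected_Ioo).isPreconnected
      isPreconnected_univ
  have houter : IsPreconnected outer := hpc _ _ isPreconnected_Ioi isPreconnected_univ
  have houter_sub : outer ⊆ (Metric.closedBall 0 s ∪ sector a b K)ᶜ := by
    rintro _ ⟨⟨r, θ⟩, ⟨hr, -⟩, rfl⟩
    simp only [Set.mem_Ioi] at hr
    exact hmem (by linarith) (by linarith) fun _ h => absurd h.2 (by linarith)
  have hray_sub : ∀ θ : ℝ, Complex.exp (θ * Complex.I) ∉ K →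
      ray θ ⊆ (Metric.closedBall 0 s ∪ sector a b K)ᶜ := by
    rintro θ hθ _ ⟨⟨r, θ'⟩, ⟨hr, rfl⟩, rfl⟩
    exact hmem hr.1 hr.2 fun h => absurd h hθ
  have hannulus_sub : annulus ⊆ (Metric.closedBall 0 s ∪ sector a b K)ᶜ := by
    rintro _ ⟨⟨r, θ⟩, ⟨hr, -⟩, rfl⟩
    exact hmem hr.1 hr.2.1 fun _ h => absurd h.1 (by linarith [hr.2.2])
  have hx_outer : ∀ θ, P (b + 1, θ) ∈ outer := fun θ => ⟨_, ⟨by simp, trivial⟩, rfl⟩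
  have hx_ray : ∀ θ, P (b + 1, θ) ∈ ray θ :=
    fun θ => ⟨(b + 1, θ), ⟨⟨by simp; linarith, by simp; linarith⟩, rfl⟩, rfl⟩
  have hor : ∀ θ, IsPreconnected (outer ∪ ray θ) := fun θ =>
    houter.union _ (hx_outer θ) (hx_ray θ) (hray θ)
  refine isPreconnected_of_forall (P (b + 1, u.arg)) fun w hw => ?_
  have hw' := hw
  rw [polar w, polar_mem_compl_iff hK ha (norm_nonneg w)] at hw'
  by_cases hθ : Complex.exp (w.arg * Complex.I) ∈ K
  · rcases lt_or_ge ‖w‖ a with hlt | hge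
    · obtain ⟨c, hc, hca⟩ : ∃ c, max s 0 < c ∧ c < a := exists_between (max_lt hsa ha)
      have hc0 : 0 < c := (le_max_right _ _).trans_lt hc
      have hsc : s < c := (le_max_left _ _).trans_lt hc
      refine ⟨(outer ∪ ray u.arg) ∪ annulus,
        Set.union_subset (Set.union_subset houter_sub (hray_sub _ hu')) hannulus_sub,
        Or.inl (Or.inl (hx_outer _)),
        Or.inr ⟨(‖w‖, w.arg), ⟨⟨norm_nonneg w, hw'.1, hlt⟩, trivial⟩, (polar w).symm⟩, ?_⟩
      exact (hor _).union (P (c, u.arg)) (Or.inr ⟨(c, u.arg), ⟨⟨hc0.le, hsc⟩, rfl⟩, rfl⟩)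
        ⟨(c, u.arg), ⟨⟨hc0.le, hsc, hca⟩, trivial⟩, rfl⟩ hannulus
    · have : b < ‖w‖ := by
        by_contra! h
        exact hw'.2 hθ ⟨hge, h⟩
      exact ⟨outer, houter_sub, hx_outer _, ⟨(‖w‖, w.arg), ⟨this, trivial⟩, (polar w).symm⟩,
        houter⟩
  · exact ⟨outer ∪ ray w.arg, Set.union_subset houter_sub (hray_sub _ hθ), Or.inl (hx_outer _),
      Or.inr ⟨(‖w‖, w.arg), ⟨⟨norm_nonneg w, hw'.1⟩, rfl⟩, (polar w).symm⟩, hor _⟩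

/-- A polynomial which is small on a closed disc and close to `1` on a disjoint sector. -/
theorem exists_polynomial_near_indicator {s a b : ℝ} {K : Set ℂ} (hKc : IsCompact K)
    (hK : K ⊆ Metric.sphere 0 1) (hK' : K ≠ Metric.sphere 0 1) (hs : 0 ≤ s) (hsa : s < a)
    (hab : a ≤ b) {ε : ℝ} (hε : 0 < ε) :
    ∃ p : ℂ[X], (∀ z ∈ Metric.closedBall (0 : ℂ) s, ‖p.eval z‖ ≤ ε) ∧
      ∀ z ∈ sector a b K, ‖p.eval z - 1‖ ≤ ε := by
  have ha : 0 < a := hs.trans_lt hsa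
  obtain ⟨c, hsc, hca⟩ := exists_between hsa
  have hc : 0 < c := hs.trans_lt hsc
  have hb : 0 < b := ha.trans_le hab
  obtain ⟨δ, hδ0, hδε, hδ1⟩ : ∃ δ : ℝ, 0 < δ ∧ δ ≤ ε / 4 ∧ δ ≤ 1 / 2 :=
    ⟨min (ε / 4) (1 / 2), by positivity, min_le_left _ _, min_le_right _ _⟩
  have ht1 : Tendsto (fun n : ℕ => (s / c) ^ n) atTop (𝓝 0) :=
    tendsto_pow_atTop_nhds_zero_of_lt_one (by positivity) ((div_lt_one hc).mpr hsc)
  have ht2 : Tendsto (fun n : ℕ => (c / a) ^ n) atTop (𝓝 0) :=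
    tendsto_pow_atTop_nhds_zero_of_lt_one (by positivity) ((div_lt_one ha).mpr hca)
  obtain ⟨N, hN1, hN2⟩ := ((ht1.eventually_lt_const hδ0).and
    (ht2.eventually_lt_const hδ0)).exists
  have hcN : 0 < c ^ N := by positivity
  have haN : 0 < a ^ N := by positivity
  have hbN : 0 < b ^ N := by positivity
  have hs1 : s ^ N ≤ δ * c ^ N := by
    rw [div_pow, div_lt_iff₀ hcN] at hN1
    exact hN1.le
  have hs2 : c ^ N ≤ δ * a ^ N := by
    rw [div_pow, div_lt_iff₀ haN] at hN2
    exact hN2.le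
  -- For large `N`, `z ^ N / (z ^ N + c ^ N)` is near 0 for `‖z‖ ≤ s < c` and near 1 for `‖z‖ ≥ a >
  -- c`.
  let q : ℂ[X] := X ^ N + C ((c : ℂ) ^ N)
  have hq : ∀ z, q.eval z = z ^ N + (c : ℂ) ^ N := fun z => by simp [q]
  have hnc : ‖(c : ℂ) ^ N‖ = c ^ N := by
    rw [norm_pow, Complex.norm_real, Real.norm_of_nonneg hc.le]
  have hball : ∀ z ∈ Metric.closedBall (0 : ℂ) s,
      ‖z ^ N‖ ≤ δ * c ^ N ∧ c ^ N / 2 ≤ ‖q.eval z‖ := by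
    intro z hz
    rw [mem_closedBall_zero_iff] at hz
    have h1 : ‖z ^ N‖ ≤ δ * c ^ N := by
      rw [norm_pow]
      exact (pow_le_pow_left₀ (norm_nonneg z) hz N).trans hs1
    refine ⟨h1, ?_⟩
    have h2 : ‖(c : ℂ) ^ N‖ ≤ ‖q.eval z‖ + ‖z ^ N‖ := by
      calc ‖(c : ℂ) ^ N‖ = ‖q.eval z - z ^ N‖ := by rw [hq, add_sub_cancel_left]
        _ ≤ _ := norm_sub_le _ _
    rw [hnc] at h2
    nlinarith
  have hsec : ∀ z ∈ sector a b K, a ^ N / 2 ≤ ‖q.eval z‖ := by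
    intro z hz
    have hz' := (norm_mem_Icc_of_mem_sector hK ha.le hz).1
    have h1 : a ^ N ≤ ‖z ^ N‖ := by
      rw [norm_pow]
      exact pow_le_pow_left₀ ha.le hz' N
    have h2 : ‖z ^ N‖ ≤ ‖q.eval z‖ + ‖(c : ℂ) ^ N‖ := by
      calc ‖z ^ N‖ = ‖q.eval z - (c : ℂ) ^ N‖ := by rw [hq, add_sub_cancel_right]
        _ ≤ _ := norm_sub_le _ _
    rw [hnc] at h2
    nlinarith
  have hL : IsCompact (Metric.closedBall 0 s ∪ sector a b K) :=
    (isCompact_closedBall 0 s).union (isCompact_sector a b hKc)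
  have hq0 : ∀ z ∈ Metric.closedBall 0 s ∪ sector a b K, q.eval z ≠ 0 := by
    rintro z (hz | hz)
    · exact norm_pos_iff.mp (lt_of_lt_of_le (by positivity) (hball z hz).2)
    · exact norm_pos_iff.mp (lt_of_lt_of_le (by positivity) (hsec z hz))
  obtain ⟨p, hp⟩ := exists_polynomial_near_inv hL
    (isPreconnected_compl_closedBall_union_sector hK hK' hsa ha hab) hq0
    -- The factor `b ^ N` absorbs the later multiplication by `z ^ N`.
    (ε := ε / 2 / b ^ N) (by positivity)
  have hnear : ∀ z ∈ Metric.closedBall 0 s ∪ sector a b K,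
      ‖z ^ N * p.eval z - z ^ N * (q.eval z)⁻¹‖ ≤ ε / 2 := by
    intro z hz
    have hzb : ‖z‖ ≤ b := by
      rcases hz with hz | hz
      · exact (mem_closedBall_zero_iff.mp hz).trans (hsa.le.trans hab)
      · exact (norm_mem_Icc_of_mem_sector hK ha.le hz).2
    rw [← mul_sub, norm_mul, norm_pow]
    calc ‖z‖ ^ N * ‖p.eval z - (q.eval z)⁻¹‖ ≤ b ^ N * (ε / 2 / b ^ N) := by
          gcongr
          exact (hp z hz).le
      _ = ε / 2 := by field_simp
  refine ⟨X ^ N * p, fun z hz => ?_, fun z hz => ?_⟩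
  · have h1 := hnear z (Or.inl hz)
    have h2 : ‖z ^ N * (q.eval z)⁻¹‖ ≤ ε / 2 := by
      obtain ⟨h3, h4⟩ := hball z hz
      rw [norm_mul, norm_inv, ← div_eq_mul_inv]
      rw [div_le_iff₀ (lt_of_lt_of_le (by positivity) h4)]
      nlinarith
    have h3 : (X ^ N * p).eval z = (z ^ N * p.eval z - z ^ N * (q.eval z)⁻¹)
        + z ^ N * (q.eval z)⁻¹ := by simp
    rw [h3]
    exact (norm_add_le _ _).trans (by linarith)
  · have h1 := hnear z (Or.inr hz)
    have h2 : ‖z ^ N * (q.eval z)⁻¹ - 1‖ ≤ ε / 2 := by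
      have h4 := hsec z hz
      have h5 : z ^ N * (q.eval z)⁻¹ - 1 = -((c : ℂ) ^ N * (q.eval z)⁻¹) := by
        have := hq0 z (Or.inr hz)
        rw [sub_eq_iff_eq_add, ← mul_inv_cancel₀ this, hq]
        ring
      rw [h5, norm_neg, norm_mul, norm_inv, hnc, ← div_eq_mul_inv]
      rw [div_le_iff₀ (lt_of_lt_of_le (by positivity) h4)]
      nlinarith
    have h3 : (X ^ N * p).eval z - 1 = (z ^ N * p.eval z - z ^ N * (q.eval z)⁻¹)
        + (z ^ N * (q.eval z)⁻¹ - 1) := by simp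
    rw [h3]
    exact (norm_add_le _ _).trans (by linarith)

/-- Polynomials are dense in the continuous functions on a proper compact subset of the circle. -/
theorem exists_polynomial_near_on_circle {K : Set ℂ} (hKc : IsCompact K)
    (hK : K ⊆ Metric.sphere 0 1) (hK' : K ≠ Metric.sphere 0 1) (φ : C(K, ℂ)) {ε : ℝ}
    (hε : 0 < ε) : ∃ p : ℂ[X], ∀ z : K, ‖p.eval (z : ℂ) - φ z‖ < ε := by
  have : CompactSpace K := isCompact_iff_compactSpace.mp hKc
  refine mem_elemental_restrict_id_iff.mp ?_ ε hε
  have hconn : IsPreconnected Kᶜ := by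
    -- A negative radius makes the ball empty, leaving only the sector, which is `K` itself.
    have h := isPreconnected_compl_closedBall_union_sector (s := -1) hK hK' (by norm_num)
      one_pos le_rfl
    have h1 : sector 1 1 K = K := by
      ext z
      simp [sector]
    rwa [Metric.closedBall_eq_empty.mpr (by norm_num), Set.empty_union, h1] at h
  induction φ using ContinuousMap.induction_on_of_compact with
  | const r => exact Subalgebra.algebraMap_mem _ r
  | id => exact Algebra.elemental.self_mem ℂ _
  -- On the unit circle conjugation is inversion, which polynomials approximate on `K`.
  | star_id =>
    refine mem_elemental_restrict_id_iff.mpr fun δ hδ => ?_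
    have hn : ∀ z ∈ K, ‖z‖ = 1 := fun z hz => by simpa using hK hz
    obtain ⟨p, hp⟩ := exists_polynomial_near_inv (q := X) hKc hconn (fun z hz => by
      rw [eval_X, ← norm_pos_iff, hn z hz]; exact one_pos) hδ
    refine ⟨p, fun z => ?_⟩
    have := hp z z.2
    rwa [eval_X, Complex.inv_eq_conj (hn z z.2)] at this
  | add f g hf hg => exact add_mem hf hg
  | mul f g hf hg => exact mul_mem hf hg
  | frequently f h =>
    have := (mem_closure_iff_frequently.mpr h)
    exact (Algebra.elemental.isClosed ℂ _).closure_subset this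

/-! ### A countable family of targets -/

theorem exists_dense_seq_polynomial :
    ∃ D : ℕ → ℂ[X], ∀ (p : ℂ[X]), ∀ ε > 0, ∃ n, ∀ z ∈ Metric.closedBall (0 : ℂ) 1,
      ‖(D n).eval z - p.eval z‖ < ε := by
  have : CompactSpace (Metric.closedBall (0 : ℂ) 1) :=
    isCompact_iff_compactSpace.mp (isCompact_closedBall 0 1)
  let F : ℂ[X] → C(Metric.closedBall (0 : ℂ) 1, ℂ) := fun p => p.toContinuousMapOn _
  have : Nonempty (Set.range F) := ⟨⟨_, 0, rfl⟩⟩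
  choose D hD using fun n => (TopologicalSpace.denseSeq (Set.range F) n).2
  refine ⟨D, fun p ε hε => ?_⟩
  obtain ⟨n, hn⟩ := (TopologicalSpace.denseRange_denseSeq (Set.range F)).exists_dist_lt
    ⟨F p, p, rfl⟩ hε
  refine ⟨n, fun z hz => ?_⟩
  rw [dist_comm, Subtype.dist_eq, ← hD n, ContinuousMap.dist_lt_iff hε] at hn
  simpa [F, dist_eq_norm] using hn ⟨z, hz⟩

/-- Remove from the circle one basic open set meeting it: a proper compact subset misses some such
set. -/
theorem exists_seq_compact_circle :
    ∃ κ : ℕ → Set ℂ, (∀ i, IsCompact (κ i) ∧ κ i ⊆ Metric.sphere 0 1 ∧ κ i ≠ Metric.sphere 0 1) ∧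
      ∀ K : Set ℂ, IsCompact K → K ⊆ Metric.sphere 0 1 → K ≠ Metric.sphere 0 1 →
        ∃ i, K ⊆ κ i := by
  let B : Set (Set ℂ) := {U | U ∈ TopologicalSpace.countableBasis ℂ ∧
    (U ∩ Metric.sphere 0 1).Nonempty}
  have hB : B.Countable := (TopologicalSpace.countable_countableBasis ℂ).mono fun U hU => hU.1
  have hex : ∀ O : Set ℂ, IsOpen O → (O ∩ Metric.sphere 0 1).Nonempty → ∃ U ∈ B, U ⊆ O := by
    rintro O hO ⟨z, hz, hz1⟩
    obtain ⟨U, hU, hzU, hUO⟩ :=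
      (TopologicalSpace.isBasis_countableBasis ℂ).exists_subset_of_mem_open hz hO
    exact ⟨U, ⟨hU, z, hzU, hz1⟩, hUO⟩
  have hne : B.Nonempty := by
    obtain ⟨U, hU, -⟩ := hex Set.univ isOpen_univ ⟨1, trivial, by simp⟩
    exact ⟨U, hU⟩
  obtain ⟨u, hu⟩ := hB.exists_eq_range hne
  have huB : ∀ i, u i ∈ B := fun i => hu ▸ Set.mem_range_self i
  refine ⟨fun i => Metric.sphere 0 1 \ u i, fun i => ⟨?_, Set.sdiff_subset, ?_⟩, ?_⟩
  · exact (isCompact_sphere 0 1).diff (TopologicalSpace.isOpen_of_mem_countableBasis (huB i).1)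
  · intro h
    obtain ⟨z, hz, hz1⟩ := (huB i).2
    rw [← h] at hz1
    exact hz1.2 hz
  · intro K hKc hK hK'
    obtain ⟨U, hU, hUK⟩ := hex Kᶜ hKc.isClosed.isOpen_compl (by
      by_contra! h
      refine hK' (hK.antisymm fun z hz => ?_)
      by_contra hzK
      exact Set.notMem_empty z (h ▸ ⟨hzK, hz⟩))
    rw [hu] at hU
    obtain ⟨i, rfl⟩ := hU
    exact ⟨i, fun z hz => ⟨hK hz, fun hzU => hUK hzU hz⟩⟩

/-- Countably many pairs of a compact set and a polynomial suffice to test universality. -/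
theorem exists_seq_targets :
    ∃ (κ : ℕ → Set ℂ) (p : ℕ → ℂ[X]),
      (∀ i, IsCompact (κ i) ∧ κ i ⊆ Metric.sphere 0 1 ∧ κ i ≠ Metric.sphere 0 1) ∧
      ∀ K : Set ℂ, IsCompact K → K ⊆ Metric.sphere 0 1 → K ≠ Metric.sphere 0 1 →
        ∀ V : Set C(K, ℂ), IsOpen V → V.Nonempty → ∃ j, K ⊆ κ j ∧ ∃ ε > 0, ∀ φ : C(K, ℂ),
          (∀ z : K, ‖φ z - (p j).eval (z : ℂ)‖ < ε) → φ ∈ V := by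
  obtain ⟨D, hD⟩ := exists_dense_seq_polynomial
  obtain ⟨κ, hκ, hκ'⟩ := exists_seq_compact_circle
  refine ⟨fun j => κ j.unpair.1, fun j => D j.unpair.2, fun i => hκ _, ?_⟩
  intro K hKc hK hK' V hV ⟨ψ, hψ⟩
  have : CompactSpace K := isCompact_iff_compactSpace.mp hKc
  obtain ⟨ε, hε, hball⟩ := Metric.isOpen_iff.mp hV ψ hψ
  obtain ⟨i, hi⟩ := hκ' K hKc hK hK'
  obtain ⟨p, hp⟩ := exists_polynomial_near_on_circle hKc hK hK' ψ (ε := ε / 3) (by positivity)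
  obtain ⟨n, hn⟩ := hD p (ε / 3) (by positivity)
  refine ⟨Nat.pair i n, by simpa using hi, ε / 3, by positivity, fun φ hφ => hball ?_⟩
  simp only [Nat.unpair_pair] at hφ
  rw [Metric.mem_ball, ContinuousMap.dist_lt_iff hε]
  intro z
  have h1 := hφ z
  have h2 := hn z (Metric.sphere_subset_closedBall (hK z.2))
  have h3 := hp z
  rw [dist_eq_norm]
  calc ‖φ z - ψ z‖ = ‖(φ z - (D n).eval (z : ℂ)) + ((D n).eval (z : ℂ) - p.eval (z : ℂ))
        + (p.eval (z : ℂ) - ψ z)‖ := by congr 1; ring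
    _ ≤ _ := norm_add₃_le
    _ < ε := by linarith

/-! ### Simultaneous approximation on a sequence of sectors -/

/-- Take `T = S + p * (q - S)` with `p` the approximate indicator of the sector; `q - S` is bounded
on the closed disc of radius `b < 1`. -/
theorem exists_step {s a b : ℝ} {K : Set ℂ} (hKc : IsCompact K) (hK : K ⊆ Metric.sphere 0 1)
    (hK' : K ≠ Metric.sphere 0 1) (hs : 0 ≤ s) (hsa : s < a) (hab : a ≤ b) (hb : b < 1)
    {S q : ℂ → ℂ} (hS : S ∈ holomorphicOnDisc) (hq : q ∈ holomorphicOnDisc) {ε : ℝ}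
    (hε : 0 < ε) :
    ∃ T ∈ holomorphicOnDisc, (∀ z ∈ Metric.closedBall (0 : ℂ) s, ‖T z - S z‖ ≤ ε) ∧
      ∀ z ∈ sector a b K, ‖T z - q z‖ ≤ ε := by
  have hd : DifferentiableOn ℂ (fun z => q z - S z) (Metric.ball 0 1) :=
    DifferentiableOn.sub hq hS
  obtain ⟨M, hM⟩ := (isCompact_closedBall (0 : ℂ) b).exists_bound_of_continuousOn
    (hd.continuousOn.mono (Metric.closedBall_subset_ball hb))
  have hM0 : 0 ≤ M := (norm_nonneg _).trans (hM 0 (by simp; linarith))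
  obtain ⟨p, hp1, hp2⟩ := exists_polynomial_near_indicator hKc hK hK' hs hsa hab
    (ε := ε / (M + 1)) (by positivity)
  have hle : ε / (M + 1) * M ≤ ε := by
    rw [div_mul_eq_mul_div, div_le_iff₀ (by positivity)]
    nlinarith
  refine ⟨fun z => S z + p.eval z * (q z - S z), ?_, fun z hz => ?_, fun z hz => ?_⟩
  · exact DifferentiableOn.add hS (p.differentiable.differentiableOn.mul hd)
  · rw [add_sub_cancel_left, norm_mul]
    refine le_trans ?_ hle
    have hz' : z ∈ Metric.closedBall (0 : ℂ) b :=
      Metric.closedBall_subset_closedBall (hsa.le.trans hab) hz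
    exact mul_le_mul (hp1 z hz) (hM z hz') (norm_nonneg _) (by positivity)
  · have h : S z + p.eval z * (q z - S z) - q z = (p.eval z - 1) * (q z - S z) := by ring
    rw [h, norm_mul]
    refine le_trans ?_ hle
    have hz' : z ∈ Metric.closedBall (0 : ℂ) b :=
      mem_closedBall_zero_iff.mpr (norm_mem_Icc_of_mem_sector hK (hs.trans hsa.le) hz).2
    exact mul_le_mul (hp2 z hz) (hM z hz') (norm_nonneg _) (by positivity)

/-- Iterating `exists_step` gives `S (k + 1)`, which differs from `S k` by at most `2 ^ (-(k + 1))`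
on the disc of radius `b k`. As `b k` tends to 1, the limit is locally uniform on the disc. On each
sector the step error and the tail of the series contribute half of the bound each. -/
theorem exists_approx_on_sectors {a b : ℕ → ℝ} (ha : ∀ k, 0 ≤ a k) (hab : ∀ k, a k ≤ b k)
    (hba : ∀ k, b k < a (k + 1)) (hb : ∀ k, b k < 1) (hlim : Tendsto a atTop (𝓝 1))
    {κ : ℕ → Set ℂ}
    (hκ : ∀ k, IsCompact (κ k) ∧ κ k ⊆ Metric.sphere 0 1 ∧ κ k ≠ Metric.sphere 0 1)
    {q : ℕ → ℂ → ℂ} (hq : ∀ k, q k ∈ holomorphicOnDisc) :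
    ∃ g ∈ holomorphicOnDisc, ∀ k, ∀ z ∈ sector (a (k + 1)) (b (k + 1)) (κ (k + 1)),
      ‖g z - q (k + 1) z‖ ≤ 1 / 2 ^ k := by
  have hstep : ∀ (k : ℕ) (S : holomorphicOnDisc), ∃ T : holomorphicOnDisc,
      (∀ z ∈ Metric.closedBall (0 : ℂ) (b k), ‖T.1 z - S.1 z‖ ≤ 1 / 2 ^ k / 2) ∧
      ∀ z ∈ sector (a (k + 1)) (b (k + 1)) (κ (k + 1)), ‖T.1 z - q (k + 1) z‖ ≤ 1 / 2 ^ k / 2 := by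
    intro k S
    obtain ⟨T, hT, h1, h2⟩ := exists_step (hκ (k + 1)).1 (hκ (k + 1)).2.1 (hκ (k + 1)).2.2
      ((ha k).trans (hab k)) (hba k) (hab (k + 1)) (hb (k + 1)) S.2 (hq (k + 1))
      (ε := 1 / 2 ^ k / 2) (by positivity)
    exact ⟨⟨T, hT⟩, h1, h2⟩
  choose next hnext1 hnext2 using hstep
  let S : ℕ → holomorphicOnDisc := fun n => Nat.rec ⟨q 0, hq 0⟩ next n
  have hSs : ∀ k, S (k + 1) = next k (S k) := fun k => rfl
  have hbmono : Monotone b := monotone_nat_of_le_succ fun k => (hba k).le.trans (hab (k + 1))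
  have hdist : ∀ k, ∀ z ∈ Metric.closedBall (0 : ℂ) (b k), ∀ i,
      dist ((S (k + i)).1 z) ((S (k + (i + 1))).1 z) ≤ 1 / 2 ^ k / 2 / 2 ^ i := by
    intro k z hz i
    have h := hnext1 (k + i) (S (k + i)) z
      (Metric.closedBall_subset_closedBall (hbmono (Nat.le_add_right k i)) hz)
    rw [dist_comm, dist_eq_norm, ← add_assoc, hSs]
    refine h.trans (le_of_eq ?_)
    rw [pow_add]
    field_simp
  have hex : ∀ r < 1, ∃ k, r < b k := fun r hr => by
    obtain ⟨k, hk⟩ := (hlim.eventually_const_lt hr).exists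
    exact ⟨k, hk.trans_le (hab k)⟩
  have hconv : ∀ z ∈ Metric.ball (0 : ℂ) 1, ∃ l, Tendsto (fun n => (S n).1 z) atTop (𝓝 l) := by
    intro z hz
    obtain ⟨k, hk⟩ := hex ‖z‖ (by simpa using hz)
    obtain ⟨l, hl⟩ := cauchySeq_tendsto_of_complete
      (cauchySeq_of_le_geometric_two (hdist k z (by simpa using hk.le)))
    refine ⟨l, (tendsto_add_atTop_iff_nat k).mp ?_⟩
    simpa only [add_comm k] using hl
  choose! g hg using hconv
  have hgS : ∀ k, ∀ z ∈ Metric.closedBall (0 : ℂ) (b k), dist ((S k).1 z) (g z) ≤ 1 / 2 ^ k := by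
    intro k z hz
    have hl : Tendsto (fun i => (S (k + i)).1 z) atTop (𝓝 (g z)) := by
      have := (tendsto_add_atTop_iff_nat k).mpr
        (hg z (Metric.closedBall_subset_ball (hb k) hz))
      simpa only [add_comm k] using this
    exact dist_le_of_le_geometric_two_of_tendsto₀ (hdist k z hz) hl
  have hpow : Tendsto (fun n : ℕ => (1 : ℝ) / 2 ^ n) atTop (𝓝 0) := by
    simpa only [one_div_pow] using
      tendsto_pow_atTop_nhds_zero_of_lt_one (r := (1 / 2 : ℝ)) (by norm_num) (by norm_num)
  refine ⟨g, ?_, fun k z hz => ?_⟩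
  · refine TendstoLocallyUniformlyOn.differentiableOn (F := fun n => (S n).1) (φ := atTop) ?_
      (Eventually.of_forall fun n => (S n).2) Metric.isOpen_ball
    rw [Metric.tendstoLocallyUniformlyOn_iff]
    intro ε hε x hx
    obtain ⟨k, hk⟩ := hex ‖x‖ (by simpa using hx)
    refine ⟨Metric.ball 0 (b k),
      mem_nhdsWithin_of_mem_nhds (Metric.isOpen_ball.mem_nhds (by simpa using hk)), ?_⟩
    filter_upwards [hpow.eventually_lt_const hε, eventually_ge_atTop k] with n hn hkn y hy
    rw [dist_comm]
    refine (hgS n y ?_).trans_lt hn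
    exact Metric.closedBall_subset_closedBall (hbmono hkn) (Metric.ball_subset_closedBall hy)
  · have hz' : z ∈ Metric.closedBall (0 : ℂ) (b (k + 1)) :=
      mem_closedBall_zero_iff.mpr
        (norm_mem_Icc_of_mem_sector (hκ (k + 1)).2.1 (ha (k + 1)) hz).2
    have h1 := hgS (k + 1) z hz'
    have h2 := hnext2 k (S k) z hz
    rw [← hSs] at h2
    rw [dist_comm, dist_eq_norm] at h1
    have h3 : (1 : ℝ) / 2 ^ (k + 1) = 1 / 2 ^ k / 2 := by rw [pow_succ, div_div]
    calc ‖g z - q (k + 1) z‖ = ‖(g z - (S (k + 1)).1 z) + ((S (k + 1)).1 z - q (k + 1) z)‖ := by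
          congr 1; ring
      _ ≤ _ := norm_add_le _ _
      _ ≤ 1 / 2 ^ k := by linarith

/-! ### Functions visiting every target along a prescribed schedule -/

theorem eventually_radial_near (p : ℂ[X]) {ε : ℝ} (hε : 0 < ε) :
    ∀ᶠ r : ℝ in 𝓝 1, ∀ z ∈ Metric.sphere (0 : ℂ) 1, ‖p.eval ((r : ℂ) * z) - p.eval z‖ < ε := by
  refine (isCompact_sphere (0 : ℂ) 1).eventually_forall_of_forall_eventually fun z _ => ?_
  have hc : Continuous fun x : ℝ × ℂ => ‖p.eval ((x.1 : ℂ) * x.2) - p.eval x.2‖ := by fun_prop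
  exact hc.continuousAt.eventually_lt continuousAt_const (by simpa using hε)

theorem mem_visitRadii_of_near {g : ℂ → ℂ} (hg : g ∈ holomorphicOnDisc) {K : Set ℂ}
    (hK : K ⊆ Metric.sphere 0 1) {V : Set C(K, ℂ)} {p : ℂ[X]} {ε : ℝ}
    (hV : ∀ φ : C(K, ℂ), (∀ z : K, ‖φ z - p.eval (z : ℂ)‖ < ε) → φ ∈ V) {r : ℝ}
    (hr : r ∈ Set.Ico (0 : ℝ) 1) (h1 : ∀ z ∈ K, ‖g (r * z) - p.eval (r * z)‖ ≤ ε / 2)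
    (h2 : ∀ z ∈ K, ‖p.eval (r * z) - p.eval z‖ < ε / 2) : r ∈ visitRadii g K V := by
  refine ⟨hr, ⟨fun z : K => g (r * z), ?_⟩, hV _ fun z => ?_, fun z => rfl⟩
  · refine ContinuousOn.comp_continuous (s := Metric.ball 0 1) hg.continuousOn (by fun_prop)
      fun z => ?_
    have hz : ‖(z : ℂ)‖ = 1 := by simpa using hK z.2
    rw [mem_ball_zero_iff, norm_mul, hz, mul_one, Complex.norm_real, Real.norm_of_nonneg hr.1]
    exact hr.2
  · calc ‖g (r * z) - p.eval (z : ℂ)‖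
        = ‖(g (r * z) - p.eval ((r : ℂ) * z)) + (p.eval ((r : ℂ) * z) - p.eval (z : ℂ))‖ := by
          congr 1; ring
      _ ≤ _ := norm_add_le _ _
      _ < ε := by linarith [h1 z z.2, h2 z z.2]

/-- The parity of `τ k` selects which of `g` and `f - g` is steered, and `τ k / 2` selects the
target. For radii near 1, `p j (r z)` is close to `p j z` uniformly on the circle, so approximation
on late sectors yields visits. -/
theorem exists_visiting_schedule {a b : ℕ → ℝ} (ha : ∀ k, 0 ≤ a k) (hab : ∀ k, a k ≤ b k)
    (hba : ∀ k, b k < a (k + 1)) (hb : ∀ k, b k < 1) (hlim : Tendsto a atTop (𝓝 1)) (τ : ℕ → ℕ)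
    {f : ℂ → ℂ} (hf : f ∈ holomorphicOnDisc) :
    ∃ g ∈ holomorphicOnDisc, f - g ∈ holomorphicOnDisc ∧
      ∀ K : Set ℂ, IsCompact K → K ⊆ Metric.sphere (0 : ℂ) 1 → K ≠ Metric.sphere (0 : ℂ) 1 →
        ∀ V : Set C(K, ℂ), IsOpen V → V.Nonempty →
          (∃ j, ∀ᶠ k in atTop, τ k = j → Set.Icc (a k) (b k) ⊆ visitRadii g K V) ∧
          ∃ j, ∀ᶠ k in atTop, τ k = j → Set.Icc (a k) (b k) ⊆ visitRadii (f - g) K V := by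
  obtain ⟨κ, p, hκ, hp⟩ := exists_seq_targets
  have hpd : ∀ j, (fun z => (p j).eval z) ∈ holomorphicOnDisc :=
    fun j => (p j).differentiable.differentiableOn
  let q : ℕ → ℂ → ℂ := fun k => if Even (τ k) then fun z => (p (τ k / 2)).eval z
    else fun z => f z - (p (τ k / 2)).eval z
  have hq : ∀ k, q k ∈ holomorphicOnDisc := by
    intro k
    by_cases h : Even (τ k)
    · simpa only [q, if_pos h] using hpd (τ k / 2)
    · simp only [q, if_neg h]
      exact DifferentiableOn.sub hf (hpd (τ k / 2))
  obtain ⟨g, hg, hgq⟩ := exists_approx_on_sectors ha hab hba hb hlim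
    (κ := fun k => κ (τ k / 2)) (fun k => hκ _) hq
  have hfg : f - g ∈ holomorphicOnDisc := DifferentiableOn.sub hf hg
  refine ⟨g, hg, hfg, fun K hKc hK hK' V hV hVne => ?_⟩
  obtain ⟨j, hKj, ε, hε, hφ⟩ := hp K hKc hK hK' V hV hVne
  obtain ⟨η, hη, hrad⟩ := Metric.eventually_nhds_iff.mp
    (eventually_radial_near (p j) (half_pos hε))
  have hpow : Tendsto (fun n : ℕ => (1 : ℝ) / 2 ^ (n - 1)) atTop (𝓝 0) := by
    simpa only [one_div_pow, Function.comp_def] using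
      (tendsto_pow_atTop_nhds_zero_of_lt_one (r := (1 / 2 : ℝ)) (by norm_num)
        (by norm_num)).comp (tendsto_sub_atTop_nat 1)
  have hev : ∀ᶠ k in atTop, 1 ≤ k ∧ (1 : ℝ) / 2 ^ (k - 1) < ε / 2 ∧ 1 - η < a k :=
    (eventually_ge_atTop 1).and ((hpow.eventually_lt_const (half_pos hε)).and
      (hlim.eventually_const_lt (by linarith)))
  have hgq' : ∀ k, 1 ≤ k → ∀ r ∈ Set.Icc (a k) (b k), ∀ z ∈ κ (τ k / 2),
      ‖g (r * z) - q k (r * z)‖ ≤ 1 / 2 ^ (k - 1) := by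
    intro k hk r hr z hz
    obtain ⟨k, rfl⟩ := Nat.exists_eq_add_of_le' hk
    exact hgq k _ (mul_mem_sector hr hz)
  refine ⟨⟨2 * j, ?_⟩, 2 * j + 1, ?_⟩
  all_goals
    filter_upwards [hev] with k ⟨hk1, hkε, hkη⟩ hτ r hr
    have hr1 : r < 1 := hr.2.trans_lt (hb k)
    have hdist : dist r 1 < η := by
      rw [Real.dist_eq, abs_lt]
      constructor <;> linarith [hr.1]
    have hτ2 : τ k / 2 = j := by omega
    have hgk := hgq' k hk1 r hr
    rw [hτ2] at hgk
  · refine mem_visitRadii_of_near hg hK hφ ⟨(ha k).trans hr.1, hr1⟩ (fun z hz => ?_)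
      fun z hz => hrad hdist z (hK hz)
    have h := hgk z (hKj hz)
    have he : Even (τ k) := hτ ▸ even_two_mul j
    simp only [q, if_pos he, hτ2] at h
    exact h.trans hkε.le
  · refine mem_visitRadii_of_near hfg hK hφ ⟨(ha k).trans hr.1, hr1⟩ (fun z hz => ?_)
      fun z hz => hrad hdist z (hK hz)
    have h := hgk z (hKj hz)
    have he : ¬ Even (τ k) := by
      rw [hτ]
      exact Nat.not_even_iff_odd.mpr (odd_two_mul_add_one j)
    simp only [q, if_neg he, hτ2] at h
    refine le_trans (le_of_eq ?_) (h.trans hkε.le)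
    rw [← norm_neg, Pi.sub_apply]
    congr 1
    ring

/-! ### Lower densities -/

theorem padicValNat_two_arith (j m : ℕ) : padicValNat 2 (2 ^ j * (2 * m + 1)) = j := by
  rw [padicValNat.mul (by positivity) (by omega), padicValNat.prime_pow,
    padicValNat.eq_zero_of_not_dvd (by omega), add_zero]

/-- The numbers of 2-adic valuation `j` form a progression of difference `2 ^ (j + 1)`. -/
theorem lowerDensity_pos {E : Set ℕ} {j : ℕ}
    (hE : ∀ᶠ n in atTop, padicValNat 2 n = j → n ∈ E) : 0 < lowerDensity E := by
  obtain ⟨M, hM⟩ := eventually_atTop.mp hE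
  let d := 2 ^ j * 2
  let c := 2 ^ j * (2 * M + 1)
  have hd : 0 < d := by positivity
  have hj : 1 ≤ 2 ^ j := Nat.one_le_two_pow
  have hc : 2 * M + 1 ≤ c := Nat.le_mul_of_pos_left _ hj
  have hcM : M ≤ c := by omega
  have hc1 : 1 ≤ c := by omega
  have hmem : ∀ m, c + m * d ∈ E := by
    intro m
    have h : c + m * d = 2 ^ j * (2 * (M + m) + 1) := by ring
    refine hM _ (hcM.trans (Nat.le_add_right _ _)) ?_
    rw [h, padicValNat_two_arith]
  have hdR : (0 : ℝ) < d := by exact_mod_cast hd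
  have hle : (1 : ℝ) / (2 * d) ≤ lowerDensity E := by
    -- A real `liminf` is meaningful only for bounded quotients, hence the first goal.
    refine le_liminf_of_le ?_ ?_
    · refine (isBoundedUnder_of ⟨1, fun n => ?_⟩).isCoboundedUnder_ge
      refine div_le_one_of_le₀ ?_ (Nat.cast_nonneg n)
      have h := Set.ncard_le_ncard (Set.inter_subset_right : E ∩ Set.Icc 1 n ⊆ _)
        (Set.finite_Icc 1 n)
      rw [← Finset.coe_Icc, Set.ncard_coe_finset, Nat.card_Icc, Finset.coe_Icc] at h
      exact_mod_cast h
    -- For `n ≥ 2 * c`, at least half of `[1, n]` lies beyond the first term `c`.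
    · filter_upwards [eventually_ge_atTop (2 * c)] with n hn
      have hn0 : (0 : ℝ) < n := by exact_mod_cast (by omega : 0 < n)
      have hsub : (fun m => c + m * d) '' Set.Iic ((n - c) / d) ⊆ E ∩ Set.Icc 1 n := by
        rintro _ ⟨m, hm, rfl⟩
        refine ⟨hmem m, le_add_right hc1, ?_⟩
        have : m * d ≤ n - c := (Nat.le_div_iff_mul_le hd).mp hm
        show c + m * d ≤ n
        omega
      have hcard := Set.ncard_le_ncard hsub ((Set.finite_Icc 1 n).inter_of_right E)
      rw [Set.ncard_image_of_injective _ (fun x y h => by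
          exact Nat.eq_of_mul_eq_mul_right hd (Nat.add_left_cancel h)),
        ← Finset.coe_Iic, Set.ncard_coe_finset, Nat.card_Iic] at hcard
      have h1 : n - c < d * ((n - c) / d + 1) := Nat.lt_mul_div_succ _ hd
      have h2 : n ≤ 2 * d * (E ∩ Set.Icc 1 n).ncard := by
        have h3 := h1.trans_le (Nat.mul_le_mul_left d hcard)
        rw [mul_assoc]
        omega
      rw [div_le_div_iff₀ (by positivity) hn0]
      have h3 : (n : ℝ) ≤ 2 * d * (E ∩ Set.Icc 1 n).ncard := by exact_mod_cast h2
      linarith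
  exact lt_of_lt_of_le (by positivity) hle

/-- A dyadic interval of length comparable to `1 / n` suffices. Valuation `j` recurs with bounded
gaps, so some such `k` exceeds `log₂ n` by a bounded amount. -/
theorem uniformLowerDensity_pos {Γ : Set ℝ} {j : ℕ}
    (hΓ : ∀ᶠ k : ℕ in atTop, padicValNat 2 k = j →
      Set.Icc (1 - 1 / 2 ^ (k + 1)) (1 - 3 / 4 / 2 ^ (k + 1)) ⊆ Γ) :
    0 < uniformLowerDensity Γ := by
  obtain ⟨M, hM⟩ := eventually_atTop.mp hΓ
  let d := 2 ^ j * 2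
  have hfin : ∀ n : ℕ, volume (Γ ∩ Set.Ico (1 - 1 / (n : ℝ)) 1) ≠ ⊤ := fun n =>
    ((measure_mono Set.inter_subset_right).trans_lt
      (by rw [Real.volume_Ico]; exact ENNReal.ofReal_lt_top)).ne
  have hle : (1 : ℝ) / 2 ^ (d + d + 4) ≤ uniformLowerDensity Γ := by
    refine le_liminf_of_le ?_ ?_
    · refine (isBoundedUnder_of ⟨1, fun n => ?_⟩).isCoboundedUnder_ge
      rcases n.eq_zero_or_pos with rfl | hn
      · simp
      have hn0 : (0 : ℝ) < n := by exact_mod_cast hn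
      have h : volume.real (Γ ∩ Set.Ico (1 - 1 / (n : ℝ)) 1) ≤ 1 / n := by
        refine (measureReal_mono Set.inter_subset_right (by simp)).trans (le_of_eq ?_)
        rw [Real.volume_real_Ico_of_le (by simp)]
        ring
      calc (n : ℝ) * _ ≤ n * (1 / n) := by gcongr
        _ = 1 := by field_simp
    · filter_upwards [eventually_ge_atTop (2 ^ M)] with n hn
      have hn1 : n ≠ 0 := (lt_of_lt_of_le (by positivity) hn).ne'
      have hn0 : (0 : ℝ) < n := by exact_mod_cast Nat.pos_of_ne_zero hn1
      let L := Nat.log 2 n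
      have hL1 : 2 ^ L ≤ n := Nat.pow_log_le_self 2 hn1
      have hL2 : n < 2 ^ (L + 1) := Nat.lt_pow_succ_log_self one_lt_two n
      have hML : M ≤ L := Nat.le_log_of_pow_le one_lt_two hn
      -- An index of valuation `j` lying between `L` and `L + 2 * d`.
      let k := 2 ^ j * (2 * (L / d + 1) + 1)
      have hk : k = d * (L / d + 1) + 2 ^ j := by simp only [k, d]; ring
      have hj : 2 ^ j ≤ d := by simp only [d]; omega
      have hd : 0 < d := by positivity
      have hLk : L ≤ k := by
        have := Nat.lt_mul_div_succ L hd
        omega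
      have hkL : k ≤ L + (d + d) := by
        have := Nat.mul_div_le L d
        rw [hk, mul_add, mul_one]
        omega
      have hsub := hM k (hML.trans hLk) (padicValNat_two_arith j _)
      have hpk : (n : ℝ) ≤ 2 ^ (k + 1) := by
        have : n ≤ 2 ^ (k + 1) := hL2.le.trans (Nat.pow_le_pow_right two_pos (by omega))
        exact_mod_cast this
      have hpn : (2 : ℝ) ^ (k + 1) ≤ n * 2 ^ (d + d + 1) := by
        have : 2 ^ (k + 1) ≤ n * 2 ^ (d + d + 1) :=
          calc 2 ^ (k + 1) ≤ 2 ^ (L + (d + d + 1)) := Nat.pow_le_pow_right two_pos (by omega)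
            _ = 2 ^ L * 2 ^ (d + d + 1) := pow_add _ _ _
            _ ≤ _ := Nat.mul_le_mul_right _ hL1
        exact_mod_cast this
      have hP : (0 : ℝ) < 2 ^ (k + 1) := by positivity
      have hsub' : Set.Icc (1 - 1 / 2 ^ (k + 1) : ℝ) (1 - 3 / 4 / 2 ^ (k + 1)) ⊆
          Γ ∩ Set.Ico (1 - 1 / (n : ℝ)) 1 := by
        refine fun r hr => ⟨hsub hr, ?_, ?_⟩
        · have : (1 : ℝ) / 2 ^ (k + 1) ≤ 1 / n := one_div_le_one_div_of_le hn0 hpk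
          linarith [hr.1]
        · have : (0 : ℝ) < 3 / 4 / 2 ^ (k + 1) := by positivity
          linarith [hr.2]
      have hvol := measureReal_mono hsub' (hfin n)
      have hlen : (1 - 3 / 4 / 2 ^ (k + 1) : ℝ) - (1 - 1 / 2 ^ (k + 1)) = 1 / 4 / 2 ^ (k + 1) := by
        ring
      rw [Real.volume_real_Icc, hlen, max_eq_left (by positivity)] at hvol
      refine le_trans ?_ (mul_le_mul_of_nonneg_left hvol hn0.le)
      rw [div_div, mul_one_div, div_le_div_iff₀ (by positivity) (by positivity)]
      have h3 : (2 : ℝ) ^ (d + d + 4) = 2 ^ (d + d + 1) * 8 := by rw [pow_add _ (d + d + 1) 3]; norm_num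
      rw [h3]
      nlinarith
  exact lt_of_lt_of_le (by positivity) hle

/-! ### The two decompositions -/

/-- Only finitely many terms lie below a given one, because the limit 1 exceeds it. Their number
ranks the terms injectively, and listing the ranks in increasing order sorts the sequence. -/
theorem exists_equiv_strictMono {ϱ : ℕ → ℝ} (h1 : ∀ n, ϱ n < 1) (hinj : Function.Injective ϱ)
    (hlim : Tendsto ϱ atTop (𝓝 1)) : ∃ e : ℕ ≃ ℕ, StrictMono (ϱ ∘ e) := by
  have hfin : ∀ n, {m | ϱ m < ϱ n}.Finite := by
    intro n
    have := hlim.eventually_const_lt (h1 n)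
    rw [← Nat.cofinite_eq_atTop] at this
    exact (eventually_cofinite.mp this).subset fun m hm => not_lt.mpr (le_of_lt hm)
  let rank : ℕ → ℕ := fun n => {m | ϱ m < ϱ n}.ncard
  have hmono : ∀ {m n}, ϱ m < ϱ n → rank m < rank n := by
    intro m n h
    refine Set.ncard_lt_ncard ⟨fun i hi => lt_trans hi h, fun hsub => ?_⟩ (hfin n)
    exact lt_irrefl (ϱ m) (hsub (show m ∈ {i | ϱ i < ϱ n} from h))
  have hrank : Function.Injective rank := by
    intro m n h
    rcases lt_trichotomy (ϱ m) (ϱ n) with hlt | heq | hgt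
    · exact absurd h (hmono hlt).ne
    · exact hinj heq
    · exact absurd h (hmono hgt).ne'
  have : Infinite (Set.range rank) := (Set.infinite_range_of_injective hrank).to_subtype
  classical
  let o := Nat.Subtype.orderIsoOfNat (Set.range rank)
  let e : ℕ ≃ ℕ := o.toEquiv.trans (Equiv.ofInjective rank hrank).symm
  have he : ∀ k, rank (e k) = o k := fun k => Equiv.apply_ofInjective_symm hrank (o k)
  refine ⟨e, fun k l hkl => ?_⟩
  have hlt : rank (e k) < rank (e l) := by
    rw [he, he]
    exact o.strictMono hkl
  by_contra! hle
  rcases hle.lt_or_eq with h | h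
  · exact absurd (hmono h) hlt.le.not_gt
  · rw [hinj h] at hlt
    exact lt_irrefl _ hlt

theorem holomorphicOnDisc_eq_add_of_subset {A : Set (ℂ → ℂ)} (hA : A ⊆ holomorphicOnDisc)
    (h : ∀ f ∈ holomorphicOnDisc, ∃ g ∈ A, f - g ∈ A) : holomorphicOnDisc = A + A := by
  refine Set.Subset.antisymm (fun f hf => ?_) ?_
  · obtain ⟨g, hg, hfg⟩ := h f hf
    exact ⟨g, hg, f - g, hfg, add_sub_cancel g f⟩
  · rintro _ ⟨g, hg, h, hh, rfl⟩
    exact DifferentiableOn.add (hA hg) (hA hh)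

theorem holomorphicOnDisc_eq_seqFrequentlyAbelUniversal_add {ϱ : ℕ → ℝ}
    (hϱ : ∀ n, ϱ n ∈ Set.Ico (0 : ℝ) 1) (hinj : Function.Injective ϱ)
    (hlim : Tendsto ϱ atTop (𝓝 1)) :
    holomorphicOnDisc = seqFrequentlyAbelUniversal ϱ + seqFrequentlyAbelUniversal ϱ := by
  refine holomorphicOnDisc_eq_add_of_subset (fun f hf => hf.1) fun f hf => ?_
  obtain ⟨e, he⟩ := exists_equiv_strictMono (fun n => (hϱ n).2) hinj hlim
  have hlim' : Tendsto (ϱ ∘ e) atTop (𝓝 1) := by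
    refine hlim.comp ?_
    rw [← Nat.cofinite_eq_atTop]
    exact e.injective.tendsto_cofinite
  obtain ⟨g, hg, hfg, hvisit⟩ := exists_visiting_schedule (fun k => (hϱ (e k)).1)
    (fun k => le_refl (ϱ (e k))) (fun k => he k.lt_succ_self) (fun k => (hϱ (e k)).2) hlim'
    -- The label depends on the original index `e k`, since the density counts indices before
    -- sorting.
    (fun k => padicValNat 2 (e k)) hf
  have hpull : ∀ {u : ℂ → ℂ} {K : Set ℂ} {V : Set C(K, ℂ)},
      (∃ j, ∀ᶠ k in atTop, padicValNat 2 (e k) = j →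
        Set.Icc (ϱ (e k)) (ϱ (e k)) ⊆ visitRadii u K V) → 0 < lowerDensity (visitTimes u K V ϱ) := by
    rintro u K V ⟨j, hj⟩
    have hsymm : Tendsto e.symm atTop atTop := by
      rw [← Nat.cofinite_eq_atTop]
      exact e.symm.injective.tendsto_cofinite
    refine lowerDensity_pos (j := j) ?_
    filter_upwards [hsymm.eventually hj] with n hn hnj
    rw [e.apply_symm_apply] at hn
    exact hn hnj ⟨le_rfl, le_rfl⟩
  exact ⟨g, ⟨hg, fun K hKc hK hK' V hV hne => hpull (hvisit K hKc hK hK' V hV hne).1⟩,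
    hfg, fun K hKc hK hK' V hV hne => hpull (hvisit K hKc hK hK' V hV hne).2⟩

theorem holomorphicOnDisc_eq_frequentlyAbelUniversal_add :
    holomorphicOnDisc = frequentlyAbelUniversal + frequentlyAbelUniversal := by
  refine holomorphicOnDisc_eq_add_of_subset (fun f hf => hf.1) fun f hf => ?_
  have hpos : ∀ k : ℕ, (0 : ℝ) < 1 / 2 ^ (k + 1) := fun k => by positivity
  have h34 : ∀ k : ℕ, (3 : ℝ) / 4 / 2 ^ (k + 1) = 3 / 4 * (1 / 2 ^ (k + 1)) := fun k => by ring
  have hsucc : ∀ k : ℕ, (1 : ℝ) / 2 ^ (k + 1 + 1) = 1 / 2 * (1 / 2 ^ (k + 1)) := fun k => by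
    rw [pow_succ]
    ring
  have hlim : Tendsto (fun k : ℕ => 1 - (1 : ℝ) / 2 ^ (k + 1)) atTop (𝓝 1) := by
    have h := (tendsto_pow_atTop_nhds_zero_of_lt_one (r := (1 / 2 : ℝ)) (by norm_num)
      (by norm_num)).comp (tendsto_add_atTop_nat 1)
    simpa [Function.comp_def] using h.const_sub 1
  obtain ⟨g, hg, hfg, hvisit⟩ := exists_visiting_schedule
    -- Any factor strictly between 1/2 and 1 in place of 3/4 keeps the intervals disjoint and of
    -- positive length.
    (a := fun k => 1 - 1 / 2 ^ (k + 1)) (b := fun k => 1 - 3 / 4 / 2 ^ (k + 1))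
    (fun k => by
      have : (1 : ℝ) / 2 ^ (k + 1) ≤ 1 := div_le_one_of_le₀ (one_le_pow₀ one_le_two) (by positivity)
      linarith)
    (fun k => by linarith [h34 k, hpos k]) (fun k => by linarith [h34 k, hpos k, hsucc k])
    (fun k => by linarith [h34 k, hpos k]) hlim (fun k => padicValNat 2 k) hf
  have hpull : ∀ {u : ℂ → ℂ} {K : Set ℂ} {V : Set C(K, ℂ)},
      (∃ j, ∀ᶠ k : ℕ in atTop, padicValNat 2 k = j →
        Set.Icc (1 - 1 / 2 ^ (k + 1)) (1 - 3 / 4 / 2 ^ (k + 1)) ⊆ visitRadii u K V) →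
        0 < uniformLowerDensity (visitRadii u K V) := by
    rintro u K V ⟨j, hj⟩
    exact uniformLowerDensity_pos hj
  exact ⟨g, ⟨hg, fun K hKc hK hK' V hV hne => hpull (hvisit K hKc hK hK' V hV hne).1⟩,
    hfg, fun K hKc hK hK' V hV hne => hpull (hvisit K hKc hK hK' V hV hne).2⟩

end AbelUniversal

theorem proposition6p7 :
    (∀ ϱ : ℕ → ℝ, (∀ n, ϱ n ∈ Set.Ico (0 : ℝ) 1) → Function.Injective ϱ →
      Tendsto ϱ atTop (𝓝 1) →
      AbelUniversal.holomorphicOnDisc =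
        AbelUniversal.seqFrequentlyAbelUniversal ϱ + AbelUniversal.seqFrequentlyAbelUniversal ϱ) ∧
    AbelUniversal.holomorphicOnDisc =
      AbelUniversal.frequentlyAbelUniversal + AbelUniversal.frequentlyAbelUniversal :=
  ⟨fun _ hϱ hinj hlim =>
      AbelUniversal.holomorphicOnDisc_eq_seqFrequentlyAbelUniversal_add hϱ hinj hlim,
    AbelUniversal.holomorphicOnDisc_eq_frequentlyAbelUniversal_add⟩
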